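/- Let $G$ be a group, let $A$ be a finite set with a map $\pi\colon A\to G$, extended to a monoid homomorphism $\pi\colon A^*\to G$ on the free monoid $A^*$, and let $\mathcal L\subseteq A^*$. Suppose that $(A,\mathcal L)$ is a (uniformly finite-to-one) biautomatic structure on $G$, that is: $\pi\colon A^*\to G$ is surjective, $\pi(A)=\pi(A)^{-1}$ and $1_G\in\pi(A)$; the language $\mathcal L$ is recognised by a finite state automaton over $A$; there is $N\ge 1$ with $1\le|\pi^{-1}(g)\cap\mathcal L|\le N$ for every $g\in G$; and there is $\zeta\ge 1$ such that, whenever $p,q$ are paths in the Cayley graph $\mathrm{Cay}(G,A)$ labelled by words in $\mathcal L$ whose starting vertices are at distance at most $1$ and whose final vertices are at distance at most $1$ in the combinatorial metric $d_A$, one has $d_A(\widehat p(t),\widehat q(t))\le\zeta$ for all integers $t\ge 0$, where $\widehat p(t)$ is the $t$-th vertex of $p$ if $t$ is at most the length of $p$, and the final vertex of $p$ otherwise. For $g\in G$ let $|g|_{\mathcal L}$ be the length of a shortest word in $\mathcal L$ representing $g$, and let $\|g\|_{\mathcal L}=\min_{h\in G}|hgh^{-1}|_{\mathcal L}$ be the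 conjugacy $\mathcal L$-word length of $g$. Suppose that $G$ is hyperbolic, that is, the Cayley graph of $G$ with respect to some finite generating set is Gromov hyperbolic. Then, for every $g\in G$, the limit $\tau_{\mathcal L}(g)=\lim_{n\to\infty}|g^n|_{\mathcal L}/n$ (the stable $\mathcal L$-word length of $g$) exists, and $$\lim_{n\to\infty}\frac{\|g^n\|_{\mathcal L}}{n}=\tau_{\mathcal L}(g).$$ -/

import Mathlib

open Filter Topology

/-- A connected graph is (Gromov) hyperbolic if its geodesic triangles are uniformly slim: for some
`δ`, every vertex on a side of a geodesic triangle is within distance `δ` of a vertex on one of the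
other two sides. -/
def SimpleGraph.IsGromovHyperbolic {V : Type*} (X : SimpleGraph V) : Prop :=
  X.Connected ∧ ∃ δ : ℕ, ∀ (x y z : V) (p : X.Walk x y) (q : X.Walk y z) (r : X.Walk x z),
    p.length = X.dist x y → q.length = X.dist y z → r.length = X.dist x z →
      ∀ u ∈ p.support, ∃ v, (v ∈ q.support ∨ v ∈ r.support) ∧ X.dist u v ≤ δ

/-- A group is hyperbolic if it has a finite generating set whose Cayley graph is hyperbolic. -/
def IsHyperbolicGroup (G : Type*) [Group G] : Prop :=
  ∃ S : Set G, S.Finite ∧ Subgroup.closure S = ⊤ ∧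
    (SimpleGraph.mulCayley S).IsGromovHyperbolic

namespace Biautomatic

variable {G A : Type*} [Group G]

/-- The element of `G` labelled by a word over the alphabet `A`, where the letters are mapped to `G`
by `π`. -/
def label (π : A → G) (w : List A) : G := (w.map π).prod

/-- The combinatorial distance `d_A` on the Cayley graph of `G` with respect to `π : A → G`. -/
noncomputable def cayDist (π : A → G) (g h : G) : ℕ :=
  (SimpleGraph.mulCayley (Set.range π)).dist g h

/-- The vertex at time `t` of the path in the Cayley graph that starts at `g` and is labelled by `w`;
from time `w.length` on it is the final vertex of the path. -/
def pathVertex (π : A → G) (g : G) (w : List A) (t : ℕ) : G := g * label π (w.take t)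

/-- `(A, L)`, with the finite alphabet `A` mapped to `G` by `π`, is a (uniformly finite-to-one)
biautomatic structure on `G`. -/
structure IsBiautomaticStructure [Finite A] (π : A → G) (L : Language A) : Prop where
  /-- `A` generates `G` as a monoid. -/
  surjective : Function.Surjective (label π)
  /-- `A` is symmetric. -/
  symm : ∀ a, ∃ b, π b = (π a)⁻¹
  /-- `A` contains the identity. -/
  one : ∃ a, π a = 1
  /-- `L` is recognised by a finite state automaton. -/
  regular : L.IsRegular
  /-- Every element of `G` has at least one and at most `N` representatives in `L`. -/
  finite_to_one : ∃ N : ℕ, 1 ≤ N ∧ ∀ g : G,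
    1 ≤ {w : List A | w ∈ L ∧ label π w = g}.encard ∧
      {w : List A | w ∈ L ∧ label π w = g}.encard ≤ N
  /-- The two-sided fellow traveller property: paths labelled by words in `L` that start at distance
  at most `1` and end at distance at most `1` from each other stay uniformly close. -/
  fellow_traveller : ∃ ζ : ℕ, 1 ≤ ζ ∧ ∀ v ∈ L, ∀ w ∈ L, ∀ g h : G,
    cayDist π g h ≤ 1 → cayDist π (g * label π v) (h * label π w) ≤ 1 →
      ∀ t : ℕ, cayDist π (pathVertex π g v t) (pathVertex π h w t) ≤ ζ

/-- The `L`-word length of `g`: the length of a shortest word in `L` representing `g`. -/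
noncomputable def wordLength (π : A → G) (L : Language A) (g : G) : ℕ :=
  sInf {n : ℕ | ∃ w ∈ L, label π w = g ∧ w.length = n}

/-- The conjugacy `L`-word length of `g`: the least `L`-word length of a conjugate of `g`. -/
noncomputable def conjWordLength (π : A → G) (L : Language A) (g : G) : ℕ :=
  ⨅ h : G, wordLength π L (h * g * h⁻¹)

/-- The stable `L`-word length of `g`: the limit of the `L`-word length of `g ^ n` divided by `n`.
(This is `limUnder`, so it is meaningful where the limit exists.) -/
noncomputable def stableWordLength (π : A → G) (L : Language A) (g : G) : ℝ :=
  limUnder atTop (fun n : ℕ => (wordLength π L (g ^ n) : ℝ) / n)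

end Biautomatic

/-!
In a graph with slim triangles, a geodesic stays uniformly close to every quasi-geodesic path with
the same endpoints: a detour of linear length around a point of the geodesic that is far from the
path would be logarithmically close to that point. In a biautomatic structure, the length of a
subword of a word of `L` is, up to a constant, the `L`-word length of the element it represents, and
this `L`-word length changes by a bounded amount when the element is multiplied by a generator on
either side. Hence paths labelled by words of `L` are quasi-geodesics, and the `L`-word length is
additive along geodesics up to a constant. Cutting a geodesic triangle with vertices `1`, `x`,
`x * y` at its centre gives `|x * y| ≤ |x| + |y| + C`.

By Fekete's lemma the stable length `τ` then exists. It is invariant under conjugation, homogeneous,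
and satisfies `τ x ≤ |x| + C`, so that `n * τ g ≤ |h * g ^ n * h⁻¹| + C` for all `h`, with `C`
independent of `n` and `h`.
-/

section QuasiSubadditive

variable {G : Type*} [Group G] {f : G → ℝ} {C : ℝ}

/-- The stable length of `g` with respect to a length function `f` on a group: the limit of
`f (g ^ n) / n`, with the junk value of `limUnder` where that limit does not exist. -/
noncomputable def stableLength (f : G → ℝ) (g : G) : ℝ :=
  limUnder atTop fun n : ℕ => f (g ^ n) / n

theorem subadditive_apply_pow_add (hf : ∀ x y, f (x * y) ≤ f x + f y + C) (g : G) :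
    Subadditive fun n => f (g ^ n) + C := fun m n => by
  have := hf (g ^ m) (g ^ n)
  rw [← pow_add] at this
  linarith

theorem bddBelow_range_apply_pow_add_div (hf₀ : ∀ x, 0 ≤ f x) (C : ℝ) (g : G) :
    BddBelow (Set.range fun n : ℕ => (f (g ^ n) + C) / n) := by
  refine ⟨-|C|, ?_⟩
  rintro _ ⟨n, rfl⟩
  rcases n.eq_zero_or_pos with rfl | hn
  · simp
  · have hn' : (1 : ℝ) ≤ n := mod_cast hn
    rw [le_div_iff₀ (by linarith)]
    nlinarith [hf₀ (g ^ n), neg_abs_le C, abs_nonneg C]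

theorem tendsto_apply_pow_div_lim (hf₀ : ∀ x, 0 ≤ f x) (hf : ∀ x y, f (x * y) ≤ f x + f y + C)
    (g : G) :
    Tendsto (fun n : ℕ => f (g ^ n) / n) atTop (𝓝 (subadditive_apply_pow_add hf g).lim) := by
  have h := (subadditive_apply_pow_add hf g).tendsto_lim
    (bddBelow_range_apply_pow_add_div hf₀ C g)
  simpa [add_div] using h.sub (tendsto_const_div_atTop_nhds_zero_nat C)

theorem tendsto_stableLength (hf₀ : ∀ x, 0 ≤ f x) (hf : ∀ x y, f (x * y) ≤ f x + f y + C)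
    (g : G) : Tendsto (fun n : ℕ => f (g ^ n) / n) atTop (𝓝 (stableLength f g)) :=
  tendsto_nhds_limUnder ⟨_, tendsto_apply_pow_div_lim hf₀ hf g⟩

theorem stableLength_le_add (hf₀ : ∀ x, 0 ≤ f x) (hf : ∀ x y, f (x * y) ≤ f x + f y + C)
    (g : G) : stableLength f g ≤ f g + C := by
  rw [stableLength, (tendsto_apply_pow_div_lim hf₀ hf g).limUnder_eq]
  simpa using (subadditive_apply_pow_add hf g).lim_le_div
    (bddBelow_range_apply_pow_add_div hf₀ C g) one_ne_zero

theorem stableLength_pow (hf₀ : ∀ x, 0 ≤ f x) (hf : ∀ x y, f (x * y) ≤ f x + f y + C)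
    (g : G) (n : ℕ) : stableLength f (g ^ n) = n * stableLength f g := by
  refine tendsto_nhds_unique (tendsto_stableLength hf₀ hf (g ^ n)) ?_
  rcases n.eq_zero_or_pos with rfl | hn
  · simpa using tendsto_const_div_atTop_nhds_zero_nat (f 1)
  · have h := ((tendsto_stableLength hf₀ hf g).comp (tendsto_id.const_mul_atTop' hn)).const_mul
      (n : ℝ)
    refine h.congr fun k => ?_
    have : (n : ℝ) ≠ 0 := by positivity
    simp only [Function.comp_apply, id_eq, Nat.cast_mul, pow_mul]
    field_simp

theorem stableLength_conj_le (hf₀ : ∀ x, 0 ≤ f x) (hf : ∀ x y, f (x * y) ≤ f x + f y + C)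
    (h g : G) : stableLength f (h * g * h⁻¹) ≤ stableLength f g := by
  have hlim := (tendsto_stableLength hf₀ hf g).add
    (tendsto_const_div_atTop_nhds_zero_nat (f h + f h⁻¹ + 2 * C))
  rw [add_zero] at hlim
  refine le_of_tendsto_of_tendsto' (tendsto_stableLength hf₀ hf (h * g * h⁻¹)) hlim fun n => ?_
  rw [← add_div, conj_pow]
  gcongr
  linarith [hf (h * g ^ n) h⁻¹, hf h (g ^ n)]

theorem stableLength_conj (hf₀ : ∀ x, 0 ≤ f x) (hf : ∀ x y, f (x * y) ≤ f x + f y + C)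
    (h g : G) : stableLength f (h * g * h⁻¹) = stableLength f g := by
  refine (stableLength_conj_le hf₀ hf h g).antisymm ?_
  simpa [mul_assoc] using stableLength_conj_le hf₀ hf h⁻¹ (h * g * h⁻¹)

theorem tendsto_iInf_conj_stableLength (hf₀ : ∀ x, 0 ≤ f x)
    (hf : ∀ x y, f (x * y) ≤ f x + f y + C) (g : G) :
    Tendsto (fun n : ℕ => (⨅ h, f (h * g ^ n * h⁻¹)) / n) atTop (𝓝 (stableLength f g)) := by
  have hlow (n : ℕ) : n * stableLength f g - C ≤ ⨅ h, f (h * g ^ n * h⁻¹) := le_ciInf fun h => by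
    have := stableLength_le_add hf₀ hf (h * g ^ n * h⁻¹)
    rw [stableLength_conj hf₀ hf, stableLength_pow hf₀ hf] at this
    linarith
  have hup (n : ℕ) : ⨅ h, f (h * g ^ n * h⁻¹) ≤ f (g ^ n) := by
    simpa using ciInf_le ⟨0, Set.forall_mem_range.2 fun h => hf₀ (h * g ^ n * h⁻¹)⟩ 1
  have hlim : Tendsto (fun n : ℕ => stableLength f g - C / n) atTop (𝓝 (stableLength f g)) := by
    simpa using tendsto_const_nhds.sub (tendsto_const_div_atTop_nhds_zero_nat C)
  refine tendsto_of_tendsto_of_tendsto_of_le_of_le' hlim (tendsto_stableLength hf₀ hf g) ?_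
    (.of_forall fun n => by gcongr; exact hup n)
  filter_upwards [eventually_gt_atTop 0] with n hn
  have hn' : (0 : ℝ) < n := mod_cast hn
  rw [le_div_iff₀ hn', sub_mul, div_mul_cancel₀ _ hn'.ne', mul_comm]
  exact hlow n

end QuasiSubadditive

section Graph

variable {V : Type*} {X : SimpleGraph V} {δ c : ℕ} {x y z u v : V}

theorem apply_le_add_dist_nsmul {M : Type*} [AddCommMonoid M] [PartialOrder M]
    [IsOrderedAddMonoid M] (hX : X.Connected) {f : V → M} {c : M}
    (hf : ∀ x y, X.Adj x y → f y ≤ f x + c) (x y : V) : f y ≤ f x + X.dist x y • c := by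
  obtain ⟨p, hp⟩ := hX.exists_walk_length_eq_dist x y
  rw [← hp]
  clear hp
  induction p with
  | nil => simp
  | @cons x z y hxz p ih =>
    calc f y ≤ f z + p.length • c := ih
      _ ≤ f x + c + p.length • c := by gcongr; exact hf x z hxz
      _ = f x + (p.length + 1) • c := by rw [succ_nsmul']; abel

/-- The geodesic interval `[x, y]` of a connected graph: the set of all vertices that lie on some
geodesic from `x` to `y`. -/
def geodesicInterval (X : SimpleGraph V) (x y : V) : Set V :=
  {u | X.dist x u + X.dist u y = X.dist x y}

theorem mem_geodesicInterval :
    u ∈ geodesicInterval X x y ↔ X.dist x u + X.dist u y = X.dist x y := Iff.rfl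

theorem left_mem_geodesicInterval : x ∈ geodesicInterval X x y := by simp [geodesicInterval]

theorem right_mem_geodesicInterval : y ∈ geodesicInterval X x y := by simp [geodesicInterval]

theorem geodesicInterval_comm (x y : V) : geodesicInterval X x y = geodesicInterval X y x := by
  ext u
  rw [mem_geodesicInterval, mem_geodesicInterval, X.dist_comm (u := x) (v := u),
    X.dist_comm (u := u) (v := y), X.dist_comm (u := x) (v := y), add_comm]

theorem geodesicInterval_subset_of_mem (hX : X.Connected) (hu : u ∈ geodesicInterval X x y) :
    geodesicInterval X x u ⊆ geodesicInterval X x y := fun v hv => by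
  have h₁ := hX.dist_triangle (u := v) (v := u) (w := y)
  have h₂ := hX.dist_triangle (u := x) (v := v) (w := y)
  simp only [mem_geodesicInterval] at *
  omega

theorem mem_geodesicInterval_of_mem_of_mem (hX : X.Connected) {a b : V}
    (hu : u ∈ geodesicInterval X a b) (hx : x ∈ geodesicInterval X a u)
    (hy : y ∈ geodesicInterval X b u) : u ∈ geodesicInterval X x y := by
  have h₁ := hX.dist_triangle (u := a) (v := x) (w := b)
  have h₂ := hX.dist_triangle (u := x) (v := y) (w := b)
  have h₃ := hX.dist_triangle (u := x) (v := u) (w := y)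
  rw [geodesicInterval_comm] at hy
  simp only [mem_geodesicInterval] at *
  omega

theorem mem_geodesicInterval_of_mem_support {p : X.Walk x y} (hX : X.Connected)
    (hp : p.length = X.dist x y) (hu : u ∈ p.support) : u ∈ geodesicInterval X x y := by
  obtain ⟨q, r, rfl⟩ := SimpleGraph.Walk.mem_support_iff_exists_append.1 hu
  rw [SimpleGraph.Walk.length_append] at hp
  have h₁ := hX.dist_triangle (u := x) (v := u) (w := y)
  have h₂ := X.dist_le q
  have h₃ := X.dist_le r
  simp only [mem_geodesicInterval]
  omega

theorem exists_mem_support_of_mem_geodesicInterval (hX : X.Connected)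
    (hu : u ∈ geodesicInterval X x y) :
    ∃ p : X.Walk x y, p.length = X.dist x y ∧ u ∈ p.support := by
  obtain ⟨q, hq⟩ := hX.exists_walk_length_eq_dist x u
  obtain ⟨r, hr⟩ := hX.exists_walk_length_eq_dist u y
  exact ⟨q.append r, by rw [SimpleGraph.Walk.length_append, hq, hr]; exact hu, by simp⟩

theorem exists_mem_geodesicInterval_dist_eq (hX : X.Connected) {k : ℕ} (hk : k ≤ X.dist x y) :
    ∃ u ∈ geodesicInterval X x y, X.dist x u = k := by
  obtain ⟨p, hp⟩ := hX.exists_walk_length_eq_dist x y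
  refine ⟨p.getVert k, mem_geodesicInterval_of_mem_support hX hp (p.getVert_mem_support k), ?_⟩
  have h₁ := X.dist_le (p.take k)
  have h₂ := X.dist_le (p.drop k)
  have h₃ := hX.dist_triangle (u := x) (v := p.getVert k) (w := y)
  rw [SimpleGraph.Walk.take_length] at h₁
  rw [SimpleGraph.Walk.drop_length] at h₂
  omega

/-- The slim triangle condition for all geodesic triangles of a graph, in terms of geodesic
intervals instead of geodesic walks. -/
def HasSlimTriangles (X : SimpleGraph V) (δ : ℕ) : Prop :=
  ∀ x y z, ∀ u ∈ geodesicInterval X x y,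
    ∃ v ∈ geodesicInterval X y z ∪ geodesicInterval X x z, X.dist u v ≤ δ

theorem exists_hasSlimTriangles (hX : X.IsGromovHyperbolic) : ∃ δ, HasSlimTriangles X δ := by
  obtain ⟨hconn, δ, hδ⟩ := hX
  refine ⟨δ, fun x y z u hu => ?_⟩
  obtain ⟨p, hp, hup⟩ := exists_mem_support_of_mem_geodesicInterval hconn hu
  obtain ⟨q, hq⟩ := hconn.exists_walk_length_eq_dist y z
  obtain ⟨r, hr⟩ := hconn.exists_walk_length_eq_dist x z
  obtain ⟨v, hv, huv⟩ := hδ x y z p q r hp hq hr u hup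
  exact ⟨v, hv.imp (mem_geodesicInterval_of_mem_support hconn hq)
    (mem_geodesicInterval_of_mem_support hconn hr), huv⟩

namespace HasSlimTriangles

theorem exists_dist_le_of_quadrilateral (h : HasSlimTriangles X δ) (hX : X.Connected) (x' y' : V)
    (hu : u ∈ geodesicInterval X x y) :
    ∃ v ∈ geodesicInterval X x x' ∪ geodesicInterval X x' y' ∪ geodesicInterval X y y',
      X.dist u v ≤ 2 * δ := by
  obtain ⟨v, hv | hv, huv⟩ := h x y y' u hu
  · exact ⟨v, .inr hv, by omega⟩
  · obtain ⟨w, hw, hvw⟩ := h x y' x' v hv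
    rw [geodesicInterval_comm y', Set.union_comm] at hw
    have := hX.dist_triangle (u := u) (v := v) (w := w)
    exact ⟨w, .inl hw, by omega⟩

/-- Walking along `[x, y]` from `x`, the first vertex close to `[y, z]` is also close to
`[x, z]`. -/
theorem exists_center (h : HasSlimTriangles X δ) (hX : X.Connected) (x y z : V) :
    ∃ u ∈ geodesicInterval X x y, ∃ v ∈ geodesicInterval X y z, ∃ w ∈ geodesicInterval X x z,
      X.dist u v ≤ δ + 1 ∧ X.dist u w ≤ δ + 1 := by
  classical
  let Close (i : ℕ) : Prop := ∃ u ∈ geodesicInterval X x y, X.dist x u = i ∧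
    ∃ v ∈ geodesicInterval X y z, X.dist u v ≤ δ
  have hex : ∃ i, Close i :=
    ⟨_, y, right_mem_geodesicInterval, rfl, y, left_mem_geodesicInterval, by simp⟩
  obtain ⟨u, hu, hxu, v, hv, huv⟩ := Nat.find_spec hex
  refine ⟨u, hu, v, hv, ?_⟩
  rcases (Nat.find hex).eq_zero_or_pos with h0 | hpos
  · obtain rfl : x = u := hX.dist_eq_zero_iff.1 (hxu.trans h0)
    exact ⟨x, left_mem_geodesicInterval, by omega, by simp⟩
  obtain ⟨u', hu', hxu'⟩ :=
    exists_mem_geodesicInterval_dist_eq hX (x := x) (y := u) (k := Nat.find hex - 1) (by omega)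
  have hu'y := geodesicInterval_subset_of_mem hX hu hu'
  obtain ⟨w, hw | hw, hu'w⟩ := h x y z u' hu'y
  · exact absurd ⟨u', hu'y, hxu', w, hw, hu'w⟩ (Nat.find_min hex (by omega))
  · have huu' : X.dist u u' = 1 := by
      rw [X.dist_comm]
      simp only [mem_geodesicInterval] at hu'
      omega
    have := hX.dist_triangle (u := u) (v := u') (w := w)
    exact ⟨w, hw, by omega, by omega⟩

theorem exists_dist_path_le (h : HasSlimTriangles X δ) (hX : X.Connected) {p : ℕ → V} {k : ℕ} :
    ∀ {s t : ℕ}, s ≤ t → t ≤ s + 2 ^ k →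
      (∀ i, s ≤ i → i < t → X.dist (p i) (p (i + 1)) ≤ c) →
      ∀ u ∈ geodesicInterval X (p s) (p t), ∃ i ∈ Set.Icc s t, X.dist u (p i) ≤ k * δ + c := by
  induction k with
  | zero =>
    intro s t hst hts hp u hu
    refine ⟨s, ⟨le_rfl, hst⟩, ?_⟩
    have hpst : X.dist (p s) (p t) ≤ c := by
      obtain rfl | rfl : t = s ∨ t = s + 1 := by omega
      · simp
      · exact hp s le_rfl (by omega)
    simp only [mem_geodesicInterval] at hu
    rw [X.dist_comm]
    omega
  | succ k ih =>
    intro s t hst hts hp u hu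
    rw [pow_succ] at hts
    obtain ⟨m, hsm, hmt, hm, hm'⟩ : ∃ m, s ≤ m ∧ m ≤ t ∧ m ≤ s + 2 ^ k ∧ t ≤ m + 2 ^ k :=
      ⟨s + (t - s) / 2, by omega⟩
    obtain ⟨v, hv, huv⟩ := h (p s) (p t) (p m) u hu
    obtain ⟨i, hi, hvi⟩ : ∃ i ∈ Set.Icc s t, X.dist v (p i) ≤ k * δ + c := by
      rcases hv with hv | hv
      · rw [geodesicInterval_comm] at hv
        obtain ⟨i, hi, hvi⟩ := ih hmt hm' (fun i hi => hp i (hsm.trans hi)) v hv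
        exact ⟨i, Set.Icc_subset_Icc_left hsm hi, hvi⟩
      · obtain ⟨i, hi, hvi⟩ := ih hsm hm (fun i hi hi' => hp i hi (hi'.trans_le hmt)) v hv
        exact ⟨i, Set.Icc_subset_Icc_right hmt hi, hvi⟩
    have := hX.dist_triangle (u := u) (v := v) (w := p i)
    exact ⟨i, hi, by rw [add_mul]; omega⟩

end HasSlimTriangles

/-- The vertex `y` is at distance `2 * D` from `u` if `a` is further away than that, and `a`
otherwise. -/
theorem exists_mem_geodesicInterval_far (hX : X.Connected) {P : Set V} {D : ℕ} {a b : V}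
    (ha : a ∈ P) (hD : ∀ y ∈ geodesicInterval X a b, ∃ q ∈ P, X.dist y q ≤ D)
    (hu : u ∈ geodesicInterval X a b) (huP : ∀ q ∈ P, D ≤ X.dist u q) :
    ∃ y ∈ geodesicInterval X a u, ∃ q ∈ P, X.dist u y ≤ 2 * D ∧ X.dist y q ≤ D ∧
      ∀ v ∈ geodesicInterval X y q, D ≤ X.dist u v := by
  rcases le_total (X.dist a u) (2 * D) with hau | hau
  · refine ⟨a, left_mem_geodesicInterval, a, ha, by rwa [X.dist_comm], by simp, fun v hv => ?_⟩
    obtain rfl : a = v := hX.dist_eq_zero_iff.1 (by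
      simp only [mem_geodesicInterval, X.dist_self] at hv
      omega)
    exact huP a ha
  · rw [X.dist_comm] at hau
    obtain ⟨y, hy, huy⟩ := exists_mem_geodesicInterval_dist_eq hX hau
    rw [geodesicInterval_comm] at hy
    obtain ⟨q, hq, hyq⟩ := hD y (geodesicInterval_subset_of_mem hX hu hy)
    refine ⟨y, hy, q, hq, huy.le, hyq, fun v hv => ?_⟩
    have := hX.dist_triangle (u := u) (v := v) (w := y)
    rw [X.dist_comm (u := v)] at this
    simp only [mem_geodesicInterval] at hv
    omega

/-- The vertices `p 0, …, p n` form a discrete quasi-geodesic of the graph `X`: consecutive vertices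
are at distance at most `c`, and the number of steps between two vertices is at most linear in
their distance. -/
structure IsQuasigeodesic (X : SimpleGraph V) (c n : ℕ) (p : ℕ → V) : Prop where
  dist_succ_le : ∀ t < n, X.dist (p t) (p (t + 1)) ≤ c
  le_add_dist : ∀ s t, s ≤ t → t ≤ n → t ≤ s + (c * X.dist (p s) (p t) + c)

namespace IsQuasigeodesic

variable {n D k : ℕ} {p : ℕ → V}

theorem exists_dist_le_of_mem_geodesicInterval (hp : IsQuasigeodesic X c n p)
    (h : HasSlimTriangles X δ) (hX : X.Connected) {s t : ℕ} (hs : s ≤ n) (ht : t ≤ n)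
    (hk : c * X.dist (p s) (p t) + c ≤ 2 ^ k) (hu : u ∈ geodesicInterval X (p s) (p t)) :
    ∃ i ≤ n, X.dist u (p i) ≤ k * δ + c := by
  wlog hst : s ≤ t generalizing s t
  · exact this ht hs (by rwa [X.dist_comm]) (by rwa [geodesicInterval_comm]) (by omega)
  have hts := hp.le_add_dist s t hst ht
  obtain ⟨i, hi, hui⟩ := h.exists_dist_path_le (k := k) hX hst (by omega)
    (fun i _ hi => hp.dist_succ_le i (hi.trans_le ht)) u hu
  exact ⟨i, hi.2.trans ht, hui⟩

/-- If `u` is a vertex of the geodesic that is furthest from the path, then a detour of length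
linear in `D`, leaving the geodesic at distance `2 * D` on either side of `u`, avoids the `D`-ball
around `u`. -/
theorem le_of_forall_le_dist (hp : IsQuasigeodesic X c n p) (h : HasSlimTriangles X δ)
    (hX : X.Connected)
    (hD : ∀ y ∈ geodesicInterval X (p 0) (p n), ∃ t ≤ n, X.dist y (p t) ≤ D)
    (hu : u ∈ geodesicInterval X (p 0) (p n)) (huD : ∀ t ≤ n, D ≤ X.dist u (p t))
    (hk : c * (6 * D) + c ≤ 2 ^ k) : D ≤ δ * k + (2 * δ + c) := by
  have hD' : ∀ y ∈ geodesicInterval X (p 0) (p n), ∃ q ∈ p '' Set.Iic n, X.dist y q ≤ D := by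
    simpa using hD
  have huP : ∀ q ∈ p '' Set.Iic n, D ≤ X.dist u q := by simpa using huD
  obtain ⟨y, hy, _, ⟨s, hs, rfl⟩, huy, hys, hyv⟩ := exists_mem_geodesicInterval_far hX
    (Set.mem_image_of_mem p (Set.mem_Iic.2 n.zero_le)) hD' hu huP
  obtain ⟨z, hz, _, ⟨t, ht, rfl⟩, huz, hzt, hzv⟩ := exists_mem_geodesicInterval_far hX
    (Set.mem_image_of_mem p (Set.mem_Iic.2 le_rfl)) (by rwa [geodesicInterval_comm])
    (by rwa [geodesicInterval_comm]) huP
  have hst : X.dist (p s) (p t) ≤ 6 * D := by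
    have h₁ := hX.dist_triangle (u := p s) (v := y) (w := p t)
    have h₂ := hX.dist_triangle (u := y) (v := u) (w := p t)
    have h₃ := hX.dist_triangle (u := u) (v := z) (w := p t)
    rw [X.dist_comm (u := p s) (v := y), X.dist_comm (u := y) (v := u)] at *
    omega
  obtain ⟨v, (hv | hv) | hv, huv⟩ := h.exists_dist_le_of_quadrilateral hX (p s) (p t)
    (mem_geodesicInterval_of_mem_of_mem hX hu hy hz)
  · have := hyv v hv
    omega
  · obtain ⟨i, hi, hvi⟩ := hp.exists_dist_le_of_mem_geodesicInterval h hX hs ht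
      ((by gcongr : _ ≤ c * (6 * D) + c).trans hk) hv
    have h₁ := hX.dist_triangle (u := u) (v := v) (w := p i)
    have h₂ := huD i hi
    rw [mul_comm] at hvi
    omega
  · have := hzv v hv
    omega

end IsQuasigeodesic

theorem exists_bound_of_forall_le_two_pow (a b m r : ℕ) :
    ∃ R, ∀ D, (∀ k, a * D + b ≤ 2 ^ k → D ≤ m * k + r) → D ≤ R := by
  obtain ⟨K, hK⟩ : ∃ K, ∀ k ≥ K, a * (m * (k + 1) + r) + b < 2 ^ k := by
    have h₁ : Tendsto (fun k : ℕ => ((a * m : ℕ) : ℝ) * ((k : ℝ) ^ 1 / 2 ^ k) +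
        ((a * (m + r) + b : ℕ) : ℝ) * ((k : ℝ) ^ 0 / 2 ^ k)) atTop (𝓝 0) := by
      simpa using ((tendsto_pow_const_div_const_pow_of_one_lt 1 one_lt_two).const_mul _).add
        ((tendsto_pow_const_div_const_pow_of_one_lt 0 one_lt_two).const_mul _)
    obtain ⟨K, hK⟩ := eventually_atTop.1 (h₁.eventually_lt_const one_pos)
    refine ⟨K, fun k hk => ?_⟩
    have h₂ := hK k hk
    rw [← mul_div_assoc, ← mul_div_assoc, ← add_div, div_lt_one (by positivity)] at h₂
    norm_cast at h₂
    linarith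
  refine ⟨m * K + r, fun D hD => ?_⟩
  by_contra! hlt
  have hKD : 2 ^ K < a * D + b := by
    by_contra! hle
    exact hlt.not_ge (hD K hle)
  have hlog := hK (Nat.log 2 (a * D + b)) (Nat.le_log_of_pow_le one_lt_two hKD.le)
  have hD' := hD _ (Nat.lt_pow_succ_log_self one_lt_two (a * D + b)).le
  have := Nat.pow_log_le_self 2 (x := a * D + b) (Nat.ne_zero_of_lt hKD)
  have := Nat.mul_le_mul_left a hD'
  rw [Nat.succ_eq_add_one] at hD' this
  omega

theorem HasSlimTriangles.exists_dist_quasigeodesic_le (h : HasSlimTriangles X δ)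
    (hX : X.Connected) (c : ℕ) :
    ∃ R, ∀ n p, IsQuasigeodesic X c n p → ∀ u ∈ geodesicInterval X (p 0) (p n),
      ∃ t ≤ n, X.dist u (p t) ≤ R := by
  classical
  obtain ⟨R, hR⟩ := exists_bound_of_forall_le_two_pow (c * 6) c δ (2 * δ + c)
  refine ⟨R, fun n p hp => ?_⟩
  have hex : ∃ D, ∀ u ∈ geodesicInterval X (p 0) (p n), ∃ t ≤ n, X.dist u (p t) ≤ D := by
    refine ⟨X.dist (p 0) (p n), fun u hu => ⟨0, n.zero_le, ?_⟩⟩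
    simp only [mem_geodesicInterval] at hu
    rw [X.dist_comm]
    omega
  suffices hDR : Nat.find hex ≤ R by
    intro u hu
    obtain ⟨t, ht, hut⟩ := Nat.find_spec hex u hu
    exact ⟨t, ht, hut.trans hDR⟩
  rcases (Nat.find hex).eq_zero_or_pos with h0 | hpos
  · omega
  have hfar := Nat.find_min hex (m := Nat.find hex - 1) (by omega)
  push Not at hfar
  obtain ⟨u, hu, hfar⟩ := hfar
  refine hR _ fun k hk => hp.le_of_forall_le_dist h hX (Nat.find_spec hex) hu (fun t ht => ?_) ?_
  · have := hfar t ht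
    omega
  · rwa [← mul_assoc]

end Graph

section Cayley

variable {G : Type*} [Group G] {S T : Set G}

theorem dist_mulCayley_mul_left_le (hS : (SimpleGraph.mulCayley S).Connected) (g x y : G) :
    (SimpleGraph.mulCayley S).dist (g * x) (g * y) ≤ (SimpleGraph.mulCayley S).dist x y := by
  obtain ⟨p, hp⟩ := hS.exists_walk_length_eq_dist x y
  let f : SimpleGraph.mulCayley S →g SimpleGraph.mulCayley S :=
    ⟨(g * ·), SimpleGraph.mulCayley_adj_mul_iff_right.2⟩
  rw [← hp, ← p.length_map f]
  exact SimpleGraph.dist_le _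

theorem dist_mulCayley_mul_left (hS : (SimpleGraph.mulCayley S).Connected) (g x y : G) :
    (SimpleGraph.mulCayley S).dist (g * x) (g * y) = (SimpleGraph.mulCayley S).dist x y :=
  (dist_mulCayley_mul_left_le hS g x y).antisymm <| by
    simpa using dist_mulCayley_mul_left_le hS g⁻¹ (g * x) (g * y)

theorem exists_dist_mulCayley_le (hfin : S.Finite) (hS : (SimpleGraph.mulCayley S).Connected)
    (hT : (SimpleGraph.mulCayley T).Connected) :
    ∃ k, ∀ x y,
      (SimpleGraph.mulCayley T).dist x y ≤ (SimpleGraph.mulCayley S).dist x y * k := by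
  obtain ⟨k, hk⟩ := (hfin.image ((SimpleGraph.mulCayley T).dist 1)).bddAbove
  have hmul (x y : G) (h : x⁻¹ * y ∈ S) : (SimpleGraph.mulCayley T).dist x y ≤ k := by
    rw [← dist_mulCayley_mul_left hT x⁻¹, inv_mul_cancel]
    exact hk ⟨_, h, rfl⟩
  have hadj (x y : G) (h : (SimpleGraph.mulCayley S).Adj x y) :
      (SimpleGraph.mulCayley T).dist x y ≤ k := by
    rcases ((SimpleGraph.mulCayley_adj S x y).1 h).2 with h | h
    · exact hmul x y h
    · rw [SimpleGraph.dist_comm]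
      exact hmul y x h
  refine ⟨k, fun x y => ?_⟩
  simpa using apply_le_add_dist_nsmul hS (f := (SimpleGraph.mulCayley T).dist x) (c := k)
    (fun u v huv => hT.dist_triangle.trans (Nat.add_le_add_left (hadj u v huv) _)) x y

end Cayley

section RegularLanguage

variable {A : Type*} {L : Language A}

theorem exists_bounded_suffix_of_isRegular (hL : L.IsRegular) :
    ∃ s, ∀ u z, u ++ z ∈ L → ∃ z' : List A, z'.length ≤ s ∧ u ++ z' ∈ L := by
  obtain ⟨s, hs⟩ := (hL.finite_range_leftQuotient.image
    fun M => sInf (List.length '' {z | z ∈ M})).bddAbove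
  refine ⟨s, fun u z huz => ?_⟩
  obtain ⟨z', hz', hlen⟩ :=
    Nat.sInf_mem (s := List.length '' {z | z ∈ L.leftQuotient u}) ⟨_, z, huz, rfl⟩
  exact ⟨z', hlen.trans_le (hs ⟨_, ⟨u, rfl⟩, rfl⟩), hz'⟩

theorem exists_bounded_prefix_of_isRegular (hL : L.IsRegular) :
    ∃ s, ∀ u z, u ++ z ∈ L → ∃ u' : List A, u'.length ≤ s ∧ u' ++ z ∈ L := by
  obtain ⟨s, hs⟩ := exists_bounded_suffix_of_isRegular hL.reverse
  refine ⟨s, fun u z huz => ?_⟩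
  obtain ⟨u', hu', h⟩ := hs z.reverse u.reverse (by simpa [Language.mem_reverse] using huz)
  exact ⟨u'.reverse, by simpa using hu', by simpa [Language.mem_reverse] using h⟩

end RegularLanguage

namespace Biautomatic

variable {G A : Type*} [Group G] {π : A → G} {L : Language A}

@[simp]
theorem label_nil : label π [] = 1 := rfl

@[simp]
theorem label_append (v w : List A) : label π (v ++ w) = label π v * label π w := by
  simp [label]

@[simp]
theorem label_cons (a : A) (w : List A) : label π (a :: w) = π a * label π w := by
  simp [label]

theorem cayDist_comm (x y : G) : cayDist π x y = cayDist π y x := SimpleGraph.dist_comm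

theorem exists_walk_length_le (π : A → G) (x : G) (w : List A) :
    ∃ p : (SimpleGraph.mulCayley (Set.range π)).Walk x (x * label π w), p.length ≤ w.length := by
  induction w generalizing x with
  | nil =>
    refine ⟨SimpleGraph.Walk.nil.copy rfl (by simp), ?_⟩
    rw [SimpleGraph.Walk.length_copy, SimpleGraph.Walk.length_nil, List.length_nil]
  | cons a w ih =>
    obtain ⟨p, hp⟩ := ih (x * π a)
    by_cases hx : x = x * π a
    · exact ⟨p.copy hx.symm (by simp [mul_assoc]), by simpa using hp.trans (Nat.le_succ _)⟩
    · have hadj : (SimpleGraph.mulCayley (Set.range π)).Adj x (x * π a) :=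
        (SimpleGraph.mulCayley_adj _ _ _).2 ⟨hx, by simp⟩
      exact ⟨(p.cons hadj).copy rfl (by simp [mul_assoc]), by simpa using hp⟩

theorem cayDist_mul_label_le (π : A → G) (x : G) (w : List A) :
    cayDist π x (x * label π w) ≤ w.length := by
  obtain ⟨p, hp⟩ := exists_walk_length_le π x w
  exact (SimpleGraph.dist_le p).trans hp

theorem connected_mulCayley_range (h : Function.Surjective (label π)) :
    (SimpleGraph.mulCayley (Set.range π)).Connected := by
  have : Nonempty G := ⟨1⟩
  refine SimpleGraph.Connected.mk fun x y => ?_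
  obtain ⟨w, hw⟩ := h (x⁻¹ * y)
  obtain ⟨p, -⟩ := exists_walk_length_le π x w
  rw [hw, mul_inv_cancel_left] at p
  exact ⟨p⟩

theorem exists_mul_label_eq_of_walk (hπ : ∀ a, ∃ b, π b = (π a)⁻¹) {x y : G}
    (p : (SimpleGraph.mulCayley (Set.range π)).Walk x y) :
    ∃ w, w.length = p.length ∧ x * label π w = y := by
  induction p with
  | nil => exact ⟨[], by simp⟩
  | @cons x y _ hxy p ih =>
    obtain ⟨w, hw, rfl⟩ := ih
    obtain ⟨a, ha⟩ : ∃ a, π a = x⁻¹ * y := by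
      rcases ((SimpleGraph.mulCayley_adj _ _ _).1 hxy).2 with ⟨a, ha⟩ | ⟨a, ha⟩
      · exact ⟨a, ha⟩
      · obtain ⟨b, hb⟩ := hπ a
        exact ⟨b, by simp [hb, ha]⟩
    exact ⟨a :: w, by simp [hw], by simp [ha, mul_assoc]⟩

theorem wordLength_le {w : List A} (hw : w ∈ L) : wordLength π L (label π w) ≤ w.length :=
  Nat.sInf_le ⟨w, hw, rfl, rfl⟩

theorem pathVertex_zero (g : G) (w : List A) : pathVertex π g w 0 = g := by simp [pathVertex]

theorem pathVertex_of_length_le (g : G) {w : List A} {t : ℕ} (ht : w.length ≤ t) :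
    pathVertex π g w t = g * label π w := by
  rw [pathVertex, List.take_of_length_le ht]

theorem inv_pathVertex_mul_pathVertex (g : G) (w : List A) {s t : ℕ} (hst : s ≤ t) :
    (pathVertex π g w s)⁻¹ * pathVertex π g w t = label π ((w.take t).drop s) := by
  have htake : w.take t = w.take s ++ (w.take t).drop s := by
    conv_lhs => rw [← List.take_append_drop s (w.take t), List.take_take, Nat.min_eq_left hst]
  rw [pathVertex, pathVertex, htake, label_append, ← htake]
  group

theorem cayDist_pathVertex_succ_le (g : G) (w : List A) (t : ℕ) :
    cayDist π (pathVertex π g w t) (pathVertex π g w (t + 1)) ≤ 1 := by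
  have h := cayDist_mul_label_le π (pathVertex π g w t) ((w.take (t + 1)).drop t)
  rw [← inv_pathVertex_mul_pathVertex g w t.le_succ, mul_inv_cancel_left] at h
  refine h.trans ?_
  rw [List.length_drop, List.length_take]
  omega

namespace IsBiautomaticStructure

variable [Finite A]

theorem connected (hL : IsBiautomaticStructure π L) :
    (SimpleGraph.mulCayley (Set.range π)).Connected :=
  connected_mulCayley_range hL.surjective

theorem exists_length_eq_cayDist (hL : IsBiautomaticStructure π L) (x y : G) :
    ∃ w, w.length = cayDist π x y ∧ x * label π w = y := by
  obtain ⟨p, hp⟩ := hL.connected.exists_walk_length_eq_dist x y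
  obtain ⟨w, hw, hxy⟩ := exists_mul_label_eq_of_walk hL.symm p
  exact ⟨w, hw.trans hp, hxy⟩

theorem exists_mem_length_eq_wordLength (hL : IsBiautomaticStructure π L) (g : G) :
    ∃ w ∈ L, label π w = g ∧ w.length = wordLength π L g := by
  obtain ⟨N, -, hN⟩ := hL.finite_to_one
  obtain ⟨w, hw, hwg⟩ := Set.one_le_encard_iff_nonempty.1 (hN g).1
  exact Nat.sInf_mem (s := {n | ∃ w ∈ L, label π w = g ∧ w.length = n}) ⟨_, w, hw, hwg, rfl⟩

theorem exists_finset_of_label_mem (hL : IsBiautomaticStructure π L) :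
    ∃ N, ∀ F : Finset G, ∃ W : Finset (List A), W.card ≤ F.card * N ∧
      ∀ w ∈ L, label π w ∈ F → w ∈ W := by
  classical
  obtain ⟨N, -, hN⟩ := hL.finite_to_one
  have hfin (g : G) := Set.finite_of_encard_le_coe (hN g).2
  refine ⟨N, fun F => ⟨F.biUnion fun g => (hfin g).toFinset, ?_, fun w hw hwF => ?_⟩⟩
  · refine Finset.card_biUnion_le_card_mul _ _ _ fun g _ => ?_
    have h := (hN g).2
    rw [(hfin g).encard_eq_coe_toFinset_card] at h
    exact_mod_cast h
  · exact Finset.mem_biUnion.2 ⟨_, hwF, by simpa using hw⟩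

/-- From time `v.length` on, the fellow traveller property keeps the path labelled by `w` near the
final vertex of the path labelled by `v`. -/
theorem exists_mem_label_eq_mul_label (hL : IsBiautomaticStructure π L) :
    ∃ r s, ∀ v ∈ L, ∀ w ∈ L, ∀ g h, cayDist π g h ≤ 1 →
      cayDist π (g * label π v) (h * label π w) ≤ 1 → ∀ j ∈ Finset.Icc v.length w.length,
        ∃ u ∈ L, (∃ z : List A, z.length ≤ r ∧ label π u = h⁻¹ * (g * label π v) * label π z) ∧
          j ≤ u.length ∧ u.length ≤ j + s := by
  obtain ⟨ζ, -, hζ⟩ := hL.fellow_traveller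
  obtain ⟨s, hs⟩ := exists_bounded_suffix_of_isRegular hL.regular
  refine ⟨ζ + s, s, fun v hv w hw g h hgh hgh' j hj => ?_⟩
  obtain ⟨hvj, hjw⟩ := Finset.mem_Icc.1 hj
  obtain ⟨z, hz, hwz⟩ := hs (w.take j) (w.drop j) (by rwa [List.take_append_drop])
  obtain ⟨e, he, hve⟩ := hL.exists_length_eq_cayDist (pathVertex π g v j) (pathVertex π h w j)
  have heζ := hζ v hv w hw g h hgh hgh' j
  rw [pathVertex_of_length_le g hvj, pathVertex] at hve
  refine ⟨w.take j ++ z, hwz, ⟨e ++ z, ?_, ?_⟩, ?_⟩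
  · rw [List.length_append]
    omega
  · rw [label_append, label_append, ← mul_assoc, mul_assoc h⁻¹, hve, inv_mul_cancel_left]
  · rw [List.length_append, List.length_take]
    omega

/-- Every time between `v.length` and `w.length` is, up to a bounded error, the length of a word of
`L` that represents one of boundedly many elements. As `L` is uniformly finite-to-one, there are
boundedly many such words. -/
theorem exists_length_le_add (hL : IsBiautomaticStructure π L) :
    ∃ C, ∀ v ∈ L, ∀ w ∈ L, ∀ g h, cayDist π g h ≤ 1 →
      cayDist π (g * label π v) (h * label π w) ≤ 1 → w.length ≤ v.length + C := by
  classical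
  obtain ⟨r, s, hrs⟩ := hL.exists_mem_label_eq_mul_label
  obtain ⟨N, hN⟩ := hL.exists_finset_of_label_mem
  let Z := (List.finite_length_le A r).toFinset
  refine ⟨Z.card * N * (s + 1), fun v hv w hw g h hgh hgh' => ?_⟩
  obtain ⟨W, hWcard, hW⟩ := hN (Z.image fun z => h⁻¹ * (g * label π v) * label π z)
  have hsub : Finset.Icc v.length w.length ⊆
      (W ×ˢ Finset.range (s + 1)).image fun q => q.1.length - q.2 := by
    intro j hj
    obtain ⟨u, hu, ⟨z, hz, huz⟩, hju, huj⟩ := hrs v hv w hw g h hgh hgh' j hj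
    have huW : u ∈ W := hW u hu (Finset.mem_image.2 ⟨z, by simpa [Z] using hz, huz.symm⟩)
    exact Finset.mem_image.2 ⟨(u, u.length - j),
      Finset.mk_mem_product huW (Finset.mem_range.2 (by omega)), by dsimp only; omega⟩
  have hcard : w.length + 1 - v.length ≤ Z.card * N * (s + 1) := calc
    w.length + 1 - v.length = (Finset.Icc v.length w.length).card := (Nat.card_Icc _ _).symm
    _ ≤ ((W ×ˢ Finset.range (s + 1)).image fun q => q.1.length - q.2).card :=
      Finset.card_le_card hsub
    _ ≤ (W ×ˢ Finset.range (s + 1)).card := Finset.card_image_le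
    _ = W.card * (s + 1) := by rw [Finset.card_product, Finset.card_range]
    _ ≤ Z.card * N * (s + 1) := by
      gcongr
      exact hWcard.trans (by gcongr; exact Finset.card_image_le)
  omega

theorem exists_length_le_wordLength_add (hL : IsBiautomaticStructure π L) :
    ∃ C, ∀ w ∈ L, w.length ≤ wordLength π L (label π w) + C := by
  obtain ⟨C, hC⟩ := hL.exists_length_le_add
  refine ⟨C, fun w hw => ?_⟩
  obtain ⟨v, hv, hvw, hlen⟩ := hL.exists_mem_length_eq_wordLength (label π w)
  rw [← hlen]
  exact hC v hv w hw 1 1 (by simp [cayDist]) (by simp [hvw, cayDist])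

theorem exists_wordLength_le_add_cayDist (hL : IsBiautomaticStructure π L) :
    ∃ C, ∀ x y x' y', wordLength π L (x'⁻¹ * y') ≤
      wordLength π L (x⁻¹ * y) + (cayDist π x x' + cayDist π y y') * C := by
  obtain ⟨C, hC⟩ := hL.exists_length_le_add
  have hlip (x y x' y' : G) (hx : cayDist π x x' ≤ 1) (hy : cayDist π y y' ≤ 1) :
      wordLength π L (x'⁻¹ * y') ≤ wordLength π L (x⁻¹ * y) + C := by
    obtain ⟨v, hv, hvx, hlen⟩ := hL.exists_mem_length_eq_wordLength (x⁻¹ * y)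
    obtain ⟨w, hw, hwx, hlen'⟩ := hL.exists_mem_length_eq_wordLength (x'⁻¹ * y')
    rw [← hlen, ← hlen']
    exact hC v hv w hw x x' hx (by rwa [hvx, hwx, mul_inv_cancel_left, mul_inv_cancel_left])
  refine ⟨C, fun x y x' y' => ?_⟩
  have hleft := apply_le_add_dist_nsmul hL.connected (f := fun x => wordLength π L (x⁻¹ * y))
    (c := C) (fun x x' hx => hlip x y x' y (SimpleGraph.dist_eq_one_iff_adj.2 hx).le
      (by simp [cayDist])) x x'
  have hright := apply_le_add_dist_nsmul hL.connected (f := fun y => wordLength π L (x'⁻¹ * y))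
    (c := C) (fun y y' hy => hlip x' y x' y' (by simp [cayDist])
      (SimpleGraph.dist_eq_one_iff_adj.2 hy).le) y y'
  rw [smul_eq_mul] at hleft hright
  rw [add_mul, ← add_assoc]
  exact hright.trans (Nat.add_le_add_right hleft _)

theorem exists_length_infix_le (hL : IsBiautomaticStructure π L) :
    ∃ C, ∀ w ∈ L, ∀ v, v <:+: w →
      v.length ≤ wordLength π L (label π v) + C ∧ wordLength π L (label π v) ≤ v.length + C := by
  obtain ⟨C₁, hC₁⟩ := hL.exists_length_le_wordLength_add
  obtain ⟨C₂, hC₂⟩ := hL.exists_wordLength_le_add_cayDist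
  obtain ⟨s, hs⟩ := exists_bounded_suffix_of_isRegular hL.regular
  obtain ⟨r, hr⟩ := exists_bounded_prefix_of_isRegular hL.regular
  refine ⟨C₁ + r + s + (r + s) * C₂, ?_⟩
  rintro _ hw v ⟨u, z, rfl⟩
  obtain ⟨z', hz', huz⟩ := hs (u ++ v) z hw
  obtain ⟨u', hu', huz⟩ := hr u (v ++ z') (by rwa [← List.append_assoc])
  have hlow := hC₁ _ huz
  have hup := wordLength_le (π := π) huz
  rw [label_append, label_append, ← mul_assoc, List.length_append, List.length_append] at hlow hup
  set x := label π u'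
  set y := x * label π v with hy
  set y' := y * label π z'
  have hxx : cayDist π 1 x ≤ r := by simpa using (cayDist_mul_label_le π 1 u').trans hu'
  have hyy : cayDist π y y' ≤ s := (cayDist_mul_label_le π y z').trans hz'
  have hle := Nat.mul_le_mul_right C₂ (Nat.add_le_add hxx hyy)
  have hlip := hC₂ 1 y' x y
  have hlip' := hC₂ x y 1 y'
  rw [cayDist_comm y' y] at hlip
  rw [cayDist_comm x 1] at hlip'
  rw [inv_one, one_mul, hy, inv_mul_cancel_left, ← hy] at hlip hlip'
  omega

theorem exists_sub_le_wordLength_pathVertex (hL : IsBiautomaticStructure π L) :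
    ∃ C, ∀ w ∈ L, ∀ g s t, s ≤ t → t ≤ w.length →
      t ≤ s + wordLength π L ((pathVertex π g w s)⁻¹ * pathVertex π g w t) + C ∧
        s + wordLength π L ((pathVertex π g w s)⁻¹ * pathVertex π g w t) ≤ t + C := by
  obtain ⟨C, hC⟩ := hL.exists_length_infix_le
  refine ⟨C, fun w hw g s t hst ht => ?_⟩
  obtain ⟨hlow, hup⟩ := hC w hw ((w.take t).drop s)
    ((List.drop_suffix _ _).isInfix.trans (List.take_prefix _ _).isInfix)
  rw [List.length_drop, List.length_take] at hlow hup
  rw [inv_pathVertex_mul_pathVertex g w hst]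
  omega

variable {S : Set G}

theorem exists_wordLength_le_add_dist (hL : IsBiautomaticStructure π L) (hfin : S.Finite)
    (hS : (SimpleGraph.mulCayley S).Connected) :
    ∃ C, ∀ x y x' y', wordLength π L (x'⁻¹ * y') ≤ wordLength π L (x⁻¹ * y) +
      ((SimpleGraph.mulCayley S).dist x x' + (SimpleGraph.mulCayley S).dist y y') * C := by
  obtain ⟨C, hC⟩ := hL.exists_wordLength_le_add_cayDist
  obtain ⟨k, hk⟩ := exists_dist_mulCayley_le hfin hS hL.connected
  refine ⟨k * C, fun x y x' y' => (hC x y x' y').trans ?_⟩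
  rw [← mul_assoc, add_mul _ _ k]
  gcongr
  exacts [hk x x', hk y y']

theorem exists_isQuasigeodesic_pathVertex (hL : IsBiautomaticStructure π L) (hfin : S.Finite)
    (hS : (SimpleGraph.mulCayley S).Connected) :
    ∃ c, ∀ w ∈ L, ∀ g,
      IsQuasigeodesic (SimpleGraph.mulCayley S) c w.length (pathVertex π g w) := by
  obtain ⟨k, hk⟩ := exists_dist_mulCayley_le (Set.finite_range π) hL.connected hS
  obtain ⟨C₁, hC₁⟩ := hL.exists_sub_le_wordLength_pathVertex
  obtain ⟨C₂, hC₂⟩ := hL.exists_wordLength_le_add_dist hfin hS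
  refine ⟨k + C₁ + C₂ + wordLength π L 1, fun w hw g => ⟨fun t _ => ?_, fun s t hst ht => ?_⟩⟩
  · have := (hk _ _).trans (Nat.mul_le_mul_right k (cayDist_pathVertex_succ_le (π := π) g w t))
    omega
  · have h₁ := (hC₁ w hw g s t hst ht).1
    have h₂ := hC₂ (pathVertex π g w s) (pathVertex π g w s) (pathVertex π g w s)
      (pathVertex π g w t)
    rw [inv_mul_cancel, SimpleGraph.dist_self, zero_add] at h₂
    nlinarith

theorem exists_wordLength_add_of_mem_geodesicInterval (hL : IsBiautomaticStructure π L)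
    (hfin : S.Finite) (hS : (SimpleGraph.mulCayley S).Connected) {δ : ℕ}
    (hδ : HasSlimTriangles (SimpleGraph.mulCayley S) δ) :
    ∃ C, ∀ x y, ∀ u ∈ geodesicInterval (SimpleGraph.mulCayley S) x y,
      wordLength π L (x⁻¹ * u) + wordLength π L (u⁻¹ * y) ≤ wordLength π L (x⁻¹ * y) + C ∧
        wordLength π L (x⁻¹ * y) ≤ wordLength π L (x⁻¹ * u) + wordLength π L (u⁻¹ * y) + C := by
  obtain ⟨c, hc⟩ := hL.exists_isQuasigeodesic_pathVertex hfin hS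
  obtain ⟨R, hR⟩ := hδ.exists_dist_quasigeodesic_le hS c
  obtain ⟨C₁, hC₁⟩ := hL.exists_sub_le_wordLength_pathVertex
  obtain ⟨C₂, hC₂⟩ := hL.exists_wordLength_le_add_dist hfin hS
  refine ⟨2 * C₁ + 2 * (R * C₂), fun x y u hu => ?_⟩
  obtain ⟨w, hw, hwxy, hlen⟩ := hL.exists_mem_length_eq_wordLength (x⁻¹ * y)
  have hend : pathVertex π x w w.length = y := by
    rw [pathVertex_of_length_le x le_rfl, hwxy, mul_inv_cancel_left]
  obtain ⟨t, ht, hut⟩ := hR _ _ (hc w hw x) u (by rwa [pathVertex_zero, hend])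
  have hlow := hC₁ w hw x 0 t t.zero_le ht
  have hup := hC₁ w hw x t w.length ht le_rfl
  rw [pathVertex_zero] at hlow
  rw [hend] at hup
  set p := pathVertex π x w t
  have hRC := Nat.mul_le_mul_right C₂ hut
  have hxu := hC₂ x p x u
  have hxp := hC₂ x u x p
  have huy := hC₂ p y u y
  have hpy := hC₂ u y p y
  simp only [SimpleGraph.dist_self, zero_add, add_zero, SimpleGraph.dist_comm (u := p)] at *
  omega

theorem exists_wordLength_mul_le (hL : IsBiautomaticStructure π L) (hG : IsHyperbolicGroup G) :
    ∃ C, ∀ x y, wordLength π L (x * y) ≤ wordLength π L x + wordLength π L y + C := by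
  obtain ⟨S, hfin, -, hS⟩ := hG
  obtain ⟨δ, hδ⟩ := exists_hasSlimTriangles hS
  obtain ⟨C₁, hC₁⟩ := hL.exists_wordLength_add_of_mem_geodesicInterval hfin hS.1 hδ
  obtain ⟨C₂, hC₂⟩ := hL.exists_wordLength_le_add_dist hfin hS.1
  refine ⟨3 * C₁ + 3 * ((δ + 1) * C₂), fun x y => ?_⟩
  obtain ⟨u, hu, v, hv, w, hw, huv, huw⟩ := hδ.exists_center hS.1 1 x (x * y)
  have hvw : (SimpleGraph.mulCayley S).dist v w ≤ 2 * (δ + 1) := by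
    have := hS.1.dist_triangle (u := v) (v := u) (w := w)
    rw [SimpleGraph.dist_comm (u := v) (v := u)] at this
    omega
  have hxy := (hC₁ _ _ w hw).2
  have hx := (hC₁ _ _ u hu).1
  have hy := (hC₁ _ _ v hv).1
  have hwu := hC₂ 1 u 1 w
  have hwv := hC₂ v (x * y) w (x * y)
  have huC := Nat.mul_le_mul_right C₂ huw
  have hvC := Nat.mul_le_mul_right C₂ hvw
  simp only [SimpleGraph.dist_self, zero_add, add_zero, inv_one, one_mul,
    inv_mul_cancel_left] at *
  rw [mul_assoc] at hvC
  omega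

end IsBiautomaticStructure

theorem natCast_conjWordLength (π : A → G) (L : Language A) (g : G) :
    (conjWordLength π L g : ℝ) = ⨅ h, (wordLength π L (h * g * h⁻¹) : ℝ) :=
  Nat.mono_cast.map_ciInf_of_continuousAt continuous_of_discreteTopology.continuousAt

end Biautomatic

theorem mainTheorem8 {G A : Type*} [Group G] [Finite A] (π : A → G) (L : Language A)
    (hG : IsHyperbolicGroup G) (hL : Biautomatic.IsBiautomaticStructure π L) (g : G) :
    Tendsto (fun n : ℕ => (Biautomatic.wordLength π L (g ^ n) : ℝ) / n) atTop
        (𝓝 (Biautomatic.stableWordLength π L g)) ∧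
      Tendsto (fun n : ℕ => (Biautomatic.conjWordLength π L (g ^ n) : ℝ) / n) atTop
        (𝓝 (Biautomatic.stableWordLength π L g)) := by
  obtain ⟨C, hC⟩ := hL.exists_wordLength_mul_le hG
  have hnonneg (x : G) : (0 : ℝ) ≤ Biautomatic.wordLength π L x := Nat.cast_nonneg _
  have hmul (x y : G) : (Biautomatic.wordLength π L (x * y) : ℝ) ≤
      Biautomatic.wordLength π L x + Biautomatic.wordLength π L y + C := mod_cast hC x y
  simp only [Biautomatic.natCast_conjWordLength]
  exact ⟨tendsto_stableLength hnonneg hmul g, tendsto_iInf_conj_stableLength hnonneg hmul g⟩
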